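/- Let $d\ge 1$ and $n\ge 1$ be integers, let $R>0$, let $X=\{x\in\mathbb{R}^d:\|x\|\le R\}$ be the closed Euclidean ball of radius $R$ centred at the origin, and let $\Sigma\in\mathbb{R}^{d\times d}$ be a symmetric positive definite matrix. Put $F(x,\xi)=\tfrac12\|x\|^2-\xi^{T}x$. For each $\mu\in\mathbb{R}^d$ (the states of nature; $\Sigma$ is fixed) let $\xi\sim N(\mu,\Sigma)$, let $f_\mu(x)=\mathbb{E}_{\xi\sim N(\mu,\Sigma)}[F(x,\xi)]$, and let the loss of an action $x\in X$ be its optimality gap $\mathcal{L}(\mu,x)=f_\mu(x)-\min_{z\in X}f_\mu(z)$. Let $\Delta^n$ be the set of maps $\delta:(\mathbb{R}^d)^n\to X$ such that, for every $\mu\in\mathbb{R}^d$, the expectation of $\delta(\xi^1,\dots,\xi^n)$ exists when $\xi^1,\dots,\xi^n$ are independent with law $N(\mu,\Sigma)$; the risk of $\delta\in\Delta^n$ is $\mathcal{R}(\mu,\delta)=\mathbb{E}[\mathcal{L}(\mu,\delta(\xi^1,\dots,\xi^n))]$ for such a sample. Then there is exactly one sample average rule, that is, exactly one map $\delta^n_{SA}:(\mathbb{R}^d)^n\to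 X$ with $$\delta^n_{SA}(\xi^1,\dots,\xi^n)\in\arg\min\Big\{\tfrac1n\sum_{i=1}^nF(x,\xi^i):x\in X\Big\}\quad\text{for all }(\xi^1,\dots,\xi^n)\in(\mathbb{R}^d)^n;$$ $\delta^n_{SA}(\xi^1,\dots,\xi^n)$ is the point of $X$ closest to the sample mean $\bar\xi=\frac1n\sum_{i=1}^n\xi^i$; and $\delta^n_{SA}$ is admissible within $\Delta^n$: it belongs to $\Delta^n$, and there is no $\delta'\in\Delta^n$ with $\mathcal{R}(\mu,\delta')\le\mathcal{R}(\mu,\delta^n_{SA})$ for all $\mu\in\mathbb{R}^d$ and $\mathcal{R}(\hat\mu,\delta')<\mathcal{R}(\hat\mu,\delta^n_{SA})$ for some $\hat\mu\in\mathbb{R}^d$. -/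

import Mathlib

open MeasureTheory ProbabilityTheory

noncomputable section

/-- The euclidean space `ℝ^d`. -/
abbrev Vec (d : ℕ) : Type := EuclideanSpace ℝ (Fin d)

/-- The objective `f(x) = 𝔼_{ξ ∼ D}[F(x, ξ)]` of the stochastic optimization problem
`min {f(x) : x ∈ X}`. -/
def expectedObjective {d : ℕ} (F : Vec d → Vec d → ℝ) (D : Measure (Vec d)) (x : Vec d) : ℝ :=
  ∫ ξ, F x ξ ∂D

/-- The loss of the action `x` when `ξ ∼ D`: the optimality gap `f(x) - min_{z ∈ X} f(z)`. -/
def optimalityGap {d : ℕ} (F : Vec d → Vec d → ℝ) (X : Set (Vec d)) (D : Measure (Vec d))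
    (x : Vec d) : ℝ :=
  expectedObjective F D x - sInf (expectedObjective F D '' X)

/-- The law of `n` independent observations `ξ^1, …, ξ^n` of `ξ ∼ D`. -/
def sampleLaw {d : ℕ} (n : ℕ) (D : Measure (Vec d)) : Measure (Fin n → Vec d) :=
  Measure.pi (fun _ : Fin n => D)

/-- The class `Δ^n` of decision rules based on `n` observations: maps from the sample space to `X`
whose expectation exists in every state of nature. -/
def IsDecisionRule {d : ℕ} {Θ : Type*} (X : Set (Vec d)) (D : Θ → Measure (Vec d)) (n : ℕ)
    (δ : (Fin n → Vec d) → Vec d) : Prop :=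
  (∀ y, δ y ∈ X) ∧ ∀ θ, Integrable δ (sampleLaw n (D θ))

/-- The risk of a decision rule when `ξ ∼ D`: the expected loss over the observed data. -/
def risk {d : ℕ} (F : Vec d → Vec d → ℝ) (X : Set (Vec d)) (n : ℕ) (D : Measure (Vec d))
    (δ : (Fin n → Vec d) → Vec d) : ℝ :=
  ∫ y, optimalityGap F X D (δ y) ∂(sampleLaw n D)

/-- `δ'` dominates `δ`: its risk is at most that of `δ` in every state of nature, and is strictly
smaller in at least one state. -/
def Dominates {d : ℕ} {Θ : Type*} (F : Vec d → Vec d → ℝ) (X : Set (Vec d))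
    (D : Θ → Measure (Vec d)) (n : ℕ) (δ' δ : (Fin n → Vec d) → Vec d) : Prop :=
  (∀ θ, risk F X n (D θ) δ' ≤ risk F X n (D θ) δ) ∧
    ∃ θ, risk F X n (D θ) δ' < risk F X n (D θ) δ

/-- `δ` is admissible within `Δ^n`: it is a decision rule that no decision rule dominates. -/
def IsAdmissible {d : ℕ} {Θ : Type*} (F : Vec d → Vec d → ℝ) (X : Set (Vec d))
    (D : Θ → Measure (Vec d)) (n : ℕ) (δ : (Fin n → Vec d) → Vec d) : Prop :=
  IsDecisionRule X D n δ ∧ ∀ δ', IsDecisionRule X D n δ' → ¬ Dominates F X D n δ' δ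

/-- `δ` is a sample average rule:
`δ(ξ^1, …, ξ^n) ∈ argmin {(1/n) ∑ᵢ F(x, ξ^i) : x ∈ X}` for all data. -/
def IsSampleAverageRule {d : ℕ} (F : Vec d → Vec d → ℝ) (X : Set (Vec d)) (n : ℕ)
    (δ : (Fin n → Vec d) → Vec d) : Prop :=
  ∀ y, δ y ∈ X ∧ IsMinOn (fun x => (1 / (n : ℝ)) * ∑ i, F x (y i)) X (δ y)

/-- The sample mean of the data. -/
def sampleMean {d : ℕ} {n : ℕ} (y : Fin n → Vec d) : Vec d :=
  (1 / (n : ℝ)) • ∑ i, y i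

/-- `p` is a closest point to `z` in `X`. -/
def IsProjection {d : ℕ} (X : Set (Vec d)) (z p : Vec d) : Prop :=
  p ∈ X ∧ ∀ x ∈ X, dist z p ≤ dist z x

/-- The quadratic objective `F(x, ξ) = ½‖x‖² - ξᵀx`. -/
def quadObjective {d : ℕ} (x ξ : Vec d) : ℝ :=
  (1 / 2) * ‖x‖ ^ 2 - inner ℝ ξ x

end

/-! The empirical objective is a quadratic depending on the data only through the sample mean. The
variational inequality for the projection `p` of that mean gives both existence and uniqueness of
the minimiser (`isSampleAverageRule_quadObjective_iff`).

Admissibility is Blyth's method. Write `μ = T θ` with `T` a square root of the covariance and weight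
`θ` by the unnormalised Gaussian `exp (-(κ/2) ‖θ‖²)`. If the rule `δ` is nowhere worse than `p`,
integrating the risk difference against this weight preserves the sign. By Fubini and completion of
the square (`integral_posterior_nonpos`), `μ` is replaced by its posterior mean `c • sampleMean y`,
`c = n / (n + κ)`, with a data weight at least 1. The integrand is then `½‖δ - p‖²` plus an inner
product that is nonnegative when the sample mean is long and otherwise at least `-(1 - c) 4R²`,
where the weight is bounded uniformly in `κ`. Hence `½ ∫ ‖δ - p‖²` is `O(κ)` under the law at `μ =
0`, so `δ = p` almost everywhere (`ae_eq_ballProj_sampleMean`). All the sample laws are absolutely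
continuous with respect to that one, so no risk can be strictly smaller. -/

/-! ### Densities of shifted Gaussian samples -/

theorem pi_withDensity {ι : Type*} [Fintype ι] {α : ι → Type*} [∀ i, MeasurableSpace (α i)]
    (m : ∀ i, Measure (α i)) [∀ i, IsProbabilityMeasure (m i)]
    (f : ∀ i, α i → ENNReal) (hf : ∀ i, Measurable (f i))
    (hfm : ∀ i, IsProbabilityMeasure ((m i).withDensity (f i))) :
    Measure.pi (fun i => (m i).withDensity (f i)) =
      (Measure.pi m).withDensity (fun x => ∏ i, f i (x i)) := by
  refine Measure.pi_eq fun s hs => ?_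
  rw [withDensity_apply _ (MeasurableSet.univ_pi hs),
    ← lintegral_indicator (MeasurableSet.univ_pi hs)]
  have h : ∀ x : ∀ i, α i, (Set.univ.pi s).indicator (fun x => ∏ i, f i (x i)) x =
      ∏ i, (s i).indicator (f i) (x i) := by
    intro x
    by_cases hx : x ∈ Set.univ.pi s
    · rw [Set.indicator_of_mem hx]
      exact Finset.prod_congr rfl fun i _ => (Set.indicator_of_mem (hx i trivial) _).symm
    · rw [Set.indicator_of_notMem hx]
      simp only [Set.mem_pi, not_forall] at hx
      obtain ⟨i, _, hi⟩ := hx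
      exact (Finset.prod_eq_zero (Finset.mem_univ i) (Set.indicator_of_notMem hi _)).symm
  simp_rw [h]
  have hm : ∀ i, Measurable ((s i).indicator (f i)) := fun i => (hf i).indicator (hs i)
  -- Coordinates are independent under a product measure, so the integral over a box factors.
  rw [lintegral_prod_eq_prod_lintegral_of_indepFun Finset.univ
    (fun i (x : ∀ i, α i) => (s i).indicator (f i) (x i))
    (iIndepFun_pi fun i => (hm i).aemeasurable)
    (fun i => (hm i).comp (measurable_pi_apply i))]
  refine Finset.prod_congr rfl fun i _ => ?_
  rw [withDensity_apply _ (hs i), ← lintegral_indicator (hs i)]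
  exact (measurePreserving_eval m i).lintegral_comp (hm i)

theorem map_withDensity_comp {α β : Type*} [MeasurableSpace α] [MeasurableSpace β]
    (μ : Measure α) {g : α → β} (hg : Measurable g) {f : β → ENNReal} (hf : Measurable f) :
    (μ.withDensity (fun x => f (g x))).map g = (μ.map g).withDensity f := by
  ext s hs
  rw [Measure.map_apply hg hs, withDensity_apply _ (hg hs), withDensity_apply _ hs,
    setLIntegral_map hs hf hg]

theorem gaussianReal_one_eq_withDensity (t : ℝ) :
    gaussianReal t 1 = (gaussianReal 0 1).withDensity
      (fun x => ENNReal.ofReal (Real.exp (t * x - t ^ 2 / 2))) := by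
  rw [gaussianReal_of_var_ne_zero t one_ne_zero, gaussianReal_of_var_ne_zero 0 one_ne_zero,
    ← withDensity_mul _ (measurable_gaussianPDF _ _) (by fun_prop)]
  congr 1
  ext x
  simp only [gaussianPDF, Pi.mul_apply]
  rw [← ENNReal.ofReal_mul (gaussianPDFReal_nonneg _ _ _)]
  congr 1
  simp only [gaussianPDFReal]
  rw [mul_assoc _ (Real.exp _) (Real.exp _), ← Real.exp_add]
  congr 2
  norm_num
  ring

theorem stdGaussian_map_const_add {d : ℕ} (θ : Vec d) :
    (stdGaussian (Vec d)).map (fun x => θ + x) = (stdGaussian (Vec d)).withDensity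
      (fun x => ENNReal.ofReal (Real.exp (inner ℝ θ x - ‖θ‖ ^ 2 / 2))) := by
  have hlp : Measurable (WithLp.toLp 2 : (Fin d → ℝ) → Vec d) := by fun_prop
  rw [← map_pi_eq_stdGaussian, ← map_withDensity_comp _ hlp (by fun_prop),
    Measure.map_map (by fun_prop) hlp]
  have h1 : (fun x : Vec d => θ + x) ∘ (WithLp.toLp 2 : (Fin d → ℝ) → Vec d) =
      (WithLp.toLp 2 : (Fin d → ℝ) → Vec d) ∘ (fun x i => θ i + x i) := by
    ext x i; simp
  rw [h1, ← Measure.map_map hlp (by fun_prop)]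
  congr 1
  have hsig : ∀ i : Fin d, SigmaFinite ((gaussianReal 0 1).map (fun x => θ i + x)) := by
    intro i
    rw [gaussianReal_map_const_add]; infer_instance
  rw [Measure.pi_map_pi (f := fun i x => θ i + x) (fun i => by fun_prop)]
  simp_rw [gaussianReal_map_const_add, zero_add, gaussianReal_one_eq_withDensity (θ _)]
  rw [pi_withDensity _ _ (fun i => by fun_prop)
    (fun i => by rw [← gaussianReal_one_eq_withDensity]; infer_instance)]
  congr 1
  ext x
  rw [← ENNReal.ofReal_prod_of_nonneg (fun i _ => (Real.exp_pos _).le), ← Real.exp_sum]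
  simp only [EuclideanSpace.real_norm_sq_eq, PiLp.inner_apply, Finset.sum_sub_distrib,
    Finset.sum_div]
  simp [mul_comm]

/-- Positive definiteness makes the square root of `S` invertible; this whitens the problem. -/
theorem exists_continuousLinearEquiv_multivariateGaussian {d : ℕ} {S : Matrix (Fin d) (Fin d) ℝ}
    (hS : S.PosDef) :
    ∃ T : Vec d ≃L[ℝ] Vec d, ∀ μ,
      multivariateGaussian μ S = (stdGaussian (Vec d)).map (fun x => μ + T x) := by
  open scoped MatrixOrder in
  have h : IsUnit (CFC.sqrt S) := CFC.isUnit_sqrt_iff_isStrictlyPositive.2 hS.isStrictlyPositive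
  obtain ⟨u, hu⟩ := h.map (Matrix.toEuclideanCLM (n := Fin d) (𝕜 := ℝ))
  refine ⟨ContinuousLinearEquiv.unitsEquiv ℝ _ u, fun μ => ?_⟩
  rw [multivariateGaussian, ← hu]
  rfl

theorem multivariateGaussian_apply_eq_withDensity {d : ℕ} {S : Matrix (Fin d) (Fin d) ℝ}
    (T : Vec d ≃L[ℝ] Vec d)
    (hT : ∀ μ, multivariateGaussian μ S = (stdGaussian (Vec d)).map (fun x => μ + T x))
    (θ : Vec d) :
    multivariateGaussian (T θ) S = (multivariateGaussian 0 S).withDensity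
      (fun x => ENNReal.ofReal (Real.exp (inner ℝ θ (T.symm x) - ‖θ‖ ^ 2 / 2))) := by
  have hTm : Measurable (fun x => T x) := T.continuous.measurable
  have h0 : multivariateGaussian 0 S = (stdGaussian (Vec d)).map (fun x => T x) := by
    simp [hT 0]
  have h1 : multivariateGaussian (T θ) S =
      ((stdGaussian (Vec d)).map (fun x => θ + x)).map (fun x => T x) := by
    rw [Measure.map_map hTm (by fun_prop), hT]
    congr 1
    ext1 x
    simp
  rw [h0, h1, stdGaussian_map_const_add, ← map_withDensity_comp _ hTm (by fun_prop)]
  simp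

/-- Sufficiency of the sample mean: the exponents of the one-observation densities add up. -/
theorem sampleLaw_multivariateGaussian_eq_withDensity {d : ℕ} {n : ℕ} (hn : 1 ≤ n)
    {S : Matrix (Fin d) (Fin d) ℝ}
    (T : Vec d ≃L[ℝ] Vec d)
    (hT : ∀ μ, multivariateGaussian μ S = (stdGaussian (Vec d)).map (fun x => μ + T x))
    (θ : Vec d) :
    sampleLaw n (multivariateGaussian (T θ) S) =
      (sampleLaw n (multivariateGaussian 0 S)).withDensity
      (fun y => ENNReal.ofReal (Real.exp
        (n * inner ℝ θ (T.symm (sampleMean y)) - n / 2 * ‖θ‖ ^ 2))) := by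
  have hn0 : (n : ℝ) ≠ 0 := by positivity
  unfold sampleLaw
  rw [multivariateGaussian_apply_eq_withDensity T hT θ,
    pi_withDensity _ _ (fun i => by fun_prop) (fun i => by
      rw [← multivariateGaussian_apply_eq_withDensity T hT θ]; infer_instance)]
  congr 1
  ext y
  rw [← ENNReal.ofReal_prod_of_nonneg (fun i _ => (Real.exp_pos _).le), ← Real.exp_sum]
  congr 2
  simp only [sampleMean, map_smul, map_sum, inner_smul_right, inner_sum, Finset.sum_sub_distrib,
    Finset.sum_const, Finset.card_univ, Fintype.card_fin, nsmul_eq_mul]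
  field_simp

/-! ### Variational inequalities for projection onto a ball -/

section BallProjection

variable {E : Type*} [NormedAddCommGroup E] [InnerProductSpace ℝ E]

/-- The closest point to `y` in the closed ball of radius `R` centred at the origin. -/
noncomputable def ballProj (R : ℝ) (y : E) : E := min 1 (R / ‖y‖) • y

theorem ballProj_of_norm_le {R : ℝ} {y : E} (hy : ‖y‖ ≤ R) : ballProj R y = y := by
  rcases eq_or_ne y 0 with rfl | h0
  · simp [ballProj]
  · have : 1 ≤ R / ‖y‖ := by
      rw [le_div_iff₀ (norm_pos_iff.2 h0)]; simpa using hy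
    simp [ballProj, this]

theorem ballProj_of_lt_norm {R : ℝ} (hR : 0 < R) {y : E} (hy : R < ‖y‖) :
    ballProj R y = (R / ‖y‖) • y := by
  have : R / ‖y‖ ≤ 1 := by
    rw [div_le_one (hR.trans hy)]; exact hy.le
  simp [ballProj, this]

theorem norm_ballProj_le {R : ℝ} (hR : 0 < R) (y : E) : ‖ballProj R y‖ ≤ R := by
  rcases le_or_gt ‖y‖ R with hy | hy
  · rwa [ballProj_of_norm_le hy]
  · have h0 := hR.trans hy
    rw [ballProj_of_lt_norm hR hy, norm_smul, Real.norm_of_nonneg (by positivity)]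
    field_simp
    exact le_rfl

/-- Outside the ball, every point of the ball lies behind the projection of `y` in the
direction of `y`. -/
theorem inner_sub_ballProj_nonpos {R : ℝ} (hR : 0 < R) {y x : E} (hy : R < ‖y‖)
    (hx : ‖x‖ ≤ R) : inner ℝ y (x - ballProj R y) ≤ 0 := by
  have h0 := hR.trans hy
  rw [ballProj_of_lt_norm hR hy, inner_sub_right, inner_smul_right, real_inner_self_eq_norm_sq]
  have h1 := real_inner_le_norm y x
  have h2 : R / ‖y‖ * ‖y‖ ^ 2 = ‖y‖ * R := by field_simp
  nlinarith [norm_nonneg y]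

/-- As long as `c • y` is not inside the open ball, its projection is still that of `y`. -/
theorem inner_ballProj_sub_smul_nonneg {R c : ℝ} (hR : 0 < R) {y x : E} (hy : R < ‖y‖)
    (hcy : R ≤ c * ‖y‖) (hx : ‖x‖ ≤ R) :
    0 ≤ inner ℝ (ballProj R y - c • y) (x - ballProj R y) := by
  have h0 := hR.trans hy
  have h := inner_sub_ballProj_nonpos hR hy hx
  have h1 : ballProj R y - c • y = (R / ‖y‖ - c) • y := by
    rw [ballProj_of_lt_norm hR hy, sub_smul]
  rw [h1, real_inner_smul_left]
  have h2 : R / ‖y‖ ≤ c := by rwa [div_le_iff₀ h0]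
  exact mul_nonneg_of_nonpos_of_nonpos (by linarith) h

theorem inner_ballProj_sub_nonneg {R : ℝ} (hR : 0 < R) (y : E) {x : E} (hx : ‖x‖ ≤ R) :
    0 ≤ inner ℝ (ballProj R y - y) (x - ballProj R y) := by
  rcases le_or_gt ‖y‖ R with hy | hy
  · simp [ballProj_of_norm_le hy]
  · simpa using inner_ballProj_sub_smul_nonneg (c := 1) hR hy (by linarith) hx

/-- A lower bound for the variational inequality at the shrunken point `c • y`. -/
theorem le_inner_ballProj_sub_smul {R c : ℝ} (hR : 0 < R) (hc : 1 / 2 ≤ c) (hc1 : c ≤ 1)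
    (y : E) {x : E} (hx : ‖x‖ ≤ R) :
    -((1 - c) * (4 * R ^ 2)) ≤ inner ℝ (ballProj R y - c • y) (x - ballProj R y) := by
  rcases le_or_gt ‖y‖ (2 * R) with hy | hy
  · have h1 : ballProj R y - c • y = (ballProj R y - y) + (1 - c) • y := by
      rw [sub_smul, one_smul]; abel
    rw [h1, inner_add_left, real_inner_smul_left]
    have h2 := inner_ballProj_sub_nonneg hR y hx
    have h3 : ‖x - ballProj R y‖ ≤ 2 * R :=
      (norm_sub_le _ _).trans (by linarith [norm_ballProj_le hR y])
    have h4 := (abs_le.1 (abs_real_inner_le_norm y (x - ballProj R y))).1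
    have h5 : ‖y‖ * ‖x - ballProj R y‖ ≤ (2 * R) * (2 * R) := by gcongr
    have h6 : (1 - c) * (-(4 * R ^ 2)) ≤ (1 - c) * inner ℝ y (x - ballProj R y) :=
      mul_le_mul_of_nonneg_left (by linarith) (by linarith)
    linarith
  -- Since `c ≥ 1/2`, the shrunken point still has norm at least `R`.
  · refine le_trans ?_ (inner_ballProj_sub_smul_nonneg hR (by linarith) (by nlinarith) hx)
    have : 0 ≤ (1 - c) * (4 * R ^ 2) := mul_nonneg (by linarith) (by positivity)
    linarith

theorem half_norm_sq_sub_inner_sub (a x p : E) :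
    (1 / 2 * ‖x‖ ^ 2 - inner ℝ a x) - (1 / 2 * ‖p‖ ^ 2 - inner ℝ a p) =
      1 / 2 * ‖x - p‖ ^ 2 + inner ℝ (p - a) (x - p) := by
  rw [norm_sub_sq_real, inner_sub_left, inner_sub_right, inner_sub_right,
    real_inner_self_eq_norm_sq, real_inner_comm x p]
  ring

theorem measurable_ballProj [MeasurableSpace E] [BorelSpace E] [SecondCountableTopology E]
    (R : ℝ) : Measurable (ballProj R : E → E) := by
  unfold ballProj
  fun_prop

theorem dist_ballProj_le {R : ℝ} (hR : 0 < R) (y : E) {x : E} (hx : ‖x‖ ≤ R) :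
    dist y (ballProj R y) ≤ dist y x := by
  have h := half_norm_sq_sub_inner_sub y x (ballProj R y)
  have h1 := inner_ballProj_sub_nonneg hR y hx
  rw [dist_eq_norm, dist_eq_norm]
  refine le_of_sq_le_sq ?_ (norm_nonneg _)
  rw [norm_sub_sq_real, norm_sub_sq_real]
  nlinarith [sq_nonneg ‖x - ballProj R y‖]

end BallProjection

/-! ### The sample average rule and the quadratic risk -/

theorem average_quadObjective {d n : ℕ} (hn : 1 ≤ n) (y : Fin n → Vec d) (x : Vec d) :
    (1 / (n : ℝ)) * ∑ i, quadObjective x (y i) =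
      1 / 2 * ‖x‖ ^ 2 - inner ℝ (sampleMean y) x := by
  have hn0 : (n : ℝ) ≠ 0 := by positivity
  simp only [quadObjective, sampleMean, Finset.sum_sub_distrib, Finset.sum_const,
    Finset.card_univ, Fintype.card_fin, nsmul_eq_mul, real_inner_smul_left, sum_inner]
  field_simp

theorem isSampleAverageRule_quadObjective_iff {d n : ℕ} (hn : 1 ≤ n) {R : ℝ} (hR : 0 < R)
    (δ : (Fin n → Vec d) → Vec d) :
    IsSampleAverageRule quadObjective (Metric.closedBall 0 R) n δ ↔
      δ = fun y => ballProj R (sampleMean y) := by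
  have key : ∀ (y : Fin n → Vec d) (x : Vec d), ‖x‖ ≤ R →
      1 / 2 * ‖x - ballProj R (sampleMean y)‖ ^ 2 ≤
      (1 / 2 * ‖x‖ ^ 2 - inner ℝ (sampleMean y) x) - (1 / 2 * ‖ballProj R (sampleMean y)‖ ^ 2 -
        inner ℝ (sampleMean y) (ballProj R (sampleMean y))) := by
    intro y x hx
    rw [half_norm_sq_sub_inner_sub]
    linarith [inner_ballProj_sub_nonneg hR (sampleMean y) hx]
  simp only [IsSampleAverageRule, average_quadObjective hn, IsMinOn, IsMinFilter,
    Filter.eventually_principal, mem_closedBall_zero_iff]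
  constructor
  · intro h
    ext1 y
    obtain ⟨h1, h2⟩ := h y
    have h3 := key y (δ y) h1
    have h4 := h2 _ (norm_ballProj_le hR (sampleMean y))
    have h5 : ‖δ y - ballProj R (sampleMean y)‖ ^ 2 ≤ 0 := by linarith
    have h6 : ‖δ y - ballProj R (sampleMean y)‖ = 0 :=
      pow_eq_zero_iff two_ne_zero |>.1 (le_antisymm h5 (sq_nonneg _))
    exact sub_eq_zero.1 (norm_eq_zero.1 h6)
  · rintro rfl y
    refine ⟨norm_ballProj_le hR _, fun x hx => ?_⟩
    have := key y x hx
    linarith [sq_nonneg ‖x - ballProj R (sampleMean y)‖]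

theorem expectedObjective_quadObjective {d : ℕ} (S : Matrix (Fin d) (Fin d) ℝ) (μ x : Vec d) :
    expectedObjective quadObjective (multivariateGaussian μ S) x =
      1 / 2 * ‖x‖ ^ 2 - inner ℝ μ x := by
  have hint : Integrable (fun ξ : Vec d => ξ) (multivariateGaussian μ S) :=
    IsGaussian.integrable_id
  simp only [expectedObjective, quadObjective]
  rw [integral_sub (integrable_const _) (hint.inner_const x)]
  simp_rw [real_inner_comm x]
  rw [integral_inner hint]
  simp [real_inner_comm]

theorem integrable_of_norm_le {Ω E : Type*} [MeasurableSpace Ω] [NormedAddCommGroup E]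
    {P : Measure Ω} [IsFiniteMeasure P] {f : Ω → E} (hf : AEStronglyMeasurable f P) (C : ℝ)
    (h : ∀ ω, ‖f ω‖ ≤ C) : Integrable f P :=
  Integrable.of_bound hf C (Filter.Eventually.of_forall h)

theorem risk_quadObjective {d n : ℕ} {R : ℝ} (S : Matrix (Fin d) (Fin d) ℝ) (μ : Vec d)
    {δ : (Fin n → Vec d) → Vec d} (hδ : ∀ y, ‖δ y‖ ≤ R)
    (hm : AEStronglyMeasurable δ (sampleLaw n (multivariateGaussian μ S))) :
    risk quadObjective (Metric.closedBall 0 R) n (multivariateGaussian μ S) δ =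
      (∫ y, (1 / 2 * ‖δ y‖ ^ 2 - inner ℝ μ (δ y)) ∂sampleLaw n (multivariateGaussian μ S)) -
        sInf (expectedObjective quadObjective (multivariateGaussian μ S) ''
          Metric.closedBall 0 R) := by
  have : IsProbabilityMeasure (sampleLaw n (multivariateGaussian μ S)) := by
    unfold sampleLaw; infer_instance
  simp only [risk, optimalityGap, expectedObjective_quadObjective]
  rw [integral_sub]
  · simp
  · refine Integrable.sub ?_ ?_
    · refine integrable_of_norm_le (by fun_prop) (1 / 2 * R ^ 2) fun y => ?_
      rw [Real.norm_of_nonneg (by positivity)]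
      have := hδ y
      gcongr
    · exact (integrable_of_norm_le hm R hδ).const_inner μ
  · exact integrable_const _

/-! ### Integration against a Gaussian prior -/

section GaussianPrior

/-- Completing the square in the product of a Gaussian likelihood and a Gaussian prior. -/
theorem exp_likelihood_mul_exp_prior {E : Type*} [NormedAddCommGroup E]
    [InnerProductSpace ℝ E] {N κ : ℝ} (hb : N + κ ≠ 0) (θ v : E) :
    Real.exp (N * inner ℝ θ v - N / 2 * ‖θ‖ ^ 2) * Real.exp (-(κ / 2) * ‖θ‖ ^ 2) =
      Real.exp (N ^ 2 / (2 * (N + κ)) * ‖v‖ ^ 2) *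
        Real.exp (-((N + κ) / 2) * ‖θ - (N / (N + κ)) • v‖ ^ 2) := by
  rw [← Real.exp_add, ← Real.exp_add, norm_sub_sq_real, norm_smul, inner_smul_right, mul_pow,
    Real.norm_eq_abs, sq_abs]
  congr 1
  field_simp
  ring

variable {E : Type*} [NormedAddCommGroup E] [InnerProductSpace ℝ E] [FiniteDimensional ℝ E]
  [MeasurableSpace E] [BorelSpace E]

theorem integrable_exp_neg_mul_norm_sq {c : ℝ} (hc : 0 < c) :
    Integrable (fun v : E => Real.exp (-c * ‖v‖ ^ 2)) := by
  have h := (GaussianFourier.integrable_cexp_neg_mul_sq_norm_add (V := E) (b := (c : ℂ))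
    (by simpa using hc) 0 0).norm
  refine h.congr (Filter.Eventually.of_forall fun v => ?_)
  simp only [Complex.norm_exp]
  congr 1
  rw [← Complex.ofReal_neg, ← Complex.ofReal_pow, zero_mul, add_zero, Complex.re_ofReal_mul,
    Complex.ofReal_re]

theorem integrable_norm_mul_exp_neg_mul_norm_sq {c : ℝ} (hc : 0 < c) :
    Integrable (fun v : E => ‖v‖ * Real.exp (-c * ‖v‖ ^ 2)) := by
  refine ((integrable_exp_neg_mul_norm_sq (E := E) (half_pos hc)).const_mul (1 + 1 / c)).mono'
    (by fun_prop) (Filter.Eventually.of_forall fun v => ?_)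
  rw [Real.norm_of_nonneg (by positivity)]
  have h1 : Real.exp (-(c / 2) * ‖v‖ ^ 2) =
      Real.exp (c / 2 * ‖v‖ ^ 2) * Real.exp (-c * ‖v‖ ^ 2) := by
    rw [← Real.exp_add]; congr 1; ring
  rw [h1, ← mul_assoc]
  refine mul_le_mul_of_nonneg_right ?_ (Real.exp_pos _).le
  have h2 := Real.add_one_le_exp (c / 2 * ‖v‖ ^ 2)
  calc ‖v‖ ≤ 1 + ‖v‖ ^ 2 / 2 := by nlinarith [sq_nonneg (‖v‖ - 1)]
    _ ≤ (1 + 1 / c) * (c / 2 * ‖v‖ ^ 2 + 1) := by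
      have : (1 + 1 / c) * (c / 2 * ‖v‖ ^ 2 + 1) =
          1 + ‖v‖ ^ 2 / 2 + (c / 2 * ‖v‖ ^ 2 + 1 / c) := by field_simp; ring
      rw [this]
      have : 0 ≤ c / 2 * ‖v‖ ^ 2 + 1 / c := by positivity
      linarith
    _ ≤ _ := by gcongr

theorem integral_inner_mul_exp_neg_mul_norm_sq (c : ℝ) (w : E) :
    ∫ v : E, inner ℝ v w * Real.exp (-c * ‖v‖ ^ 2) = 0 := by
  have h := integral_neg_eq_self (fun v : E => inner ℝ v w * Real.exp (-c * ‖v‖ ^ 2)) volume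
  simp only [inner_neg_left, norm_neg, neg_mul, integral_neg] at h ⊢
  linarith

theorem integrable_inner_mul_exp_neg_mul_norm_sq {c : ℝ} (hc : 0 < c) (w : E) :
    Integrable (fun v : E => inner ℝ v w * Real.exp (-c * ‖v‖ ^ 2)) := by
  refine ((integrable_norm_mul_exp_neg_mul_norm_sq (E := E) hc).const_mul ‖w‖).mono'
    (by fun_prop) (Filter.Eventually.of_forall fun v => ?_)
  rw [norm_mul, Real.norm_of_nonneg (Real.exp_pos _).le, ← mul_assoc]
  gcongr
  rw [mul_comm]
  exact norm_inner_le_norm v w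

/-- The integral of an affine function against a shifted Gaussian weight. -/
theorem integral_affine_mul_exp_neg_mul_norm_sub_sq {c : ℝ} (hc : 0 < c) (p : ℝ) (w a : E) :
    ∫ v : E, (p - inner ℝ v w) * Real.exp (-c * ‖v - a‖ ^ 2) =
      (p - inner ℝ a w) * ∫ v : E, Real.exp (-c * ‖v‖ ^ 2) := by
  rw [← integral_add_right_eq_self _ a]
  simp only [add_sub_cancel_right, inner_add_left]
  have : ∀ v : E, (p - (inner ℝ v w + inner ℝ a w)) * Real.exp (-c * ‖v‖ ^ 2) =
      (p - inner ℝ a w) * Real.exp (-c * ‖v‖ ^ 2) -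
        inner ℝ v w * Real.exp (-c * ‖v‖ ^ 2) := fun v => by ring
  simp_rw [this]
  rw [integral_sub ((integrable_exp_neg_mul_norm_sq hc).const_mul _)
    (integrable_inner_mul_exp_neg_mul_norm_sq hc w), integral_inner_mul_exp_neg_mul_norm_sq,
    integral_const_mul, sub_zero]

/-- If an affine function of the parameter, integrated against a Gaussian likelihood, is
nonpositive at every parameter, then so is its integral against the mixture of the likelihood
over a centred Gaussian weight, where the parameter is replaced by its posterior mean. -/
theorem integral_posterior_nonpos {Ω : Type*} [MeasurableSpace Ω] {P : Measure Ω}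
    [IsProbabilityMeasure P] {V ψ : Ω → E} {φ : Ω → ℝ} {N κ A B : ℝ} (hN : 0 < N) (hκ : 0 < κ)
    (hV : Measurable V) (hψ : AEStronglyMeasurable ψ P) (hφ : AEStronglyMeasurable φ P)
    (hψB : ∀ ω, ‖ψ ω‖ ≤ B) (hφA : ∀ ω, ‖φ ω‖ ≤ A)
    (hL : ∀ θ : E, Integrable (fun ω => Real.exp (N * inner ℝ θ (V ω) - N / 2 * ‖θ‖ ^ 2)) P)
    (hL1 : ∀ θ : E, ∫ ω, Real.exp (N * inner ℝ θ (V ω) - N / 2 * ‖θ‖ ^ 2) ∂P = 1)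
    (hdom : ∀ θ : E, ∫ ω, (φ ω - inner ℝ θ (ψ ω)) *
      Real.exp (N * inner ℝ θ (V ω) - N / 2 * ‖θ‖ ^ 2) ∂P ≤ 0) :
    Integrable (fun ω => (φ ω - inner ℝ ((N / (N + κ)) • V ω) (ψ ω)) *
      Real.exp (N ^ 2 / (2 * (N + κ)) * ‖V ω‖ ^ 2)) P ∧
    ∫ ω, (φ ω - inner ℝ ((N / (N + κ)) • V ω) (ψ ω)) *
      Real.exp (N ^ 2 / (2 * (N + κ)) * ‖V ω‖ ^ 2) ∂P ≤ 0 := by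
  have hb : 0 < N + κ := by positivity
  set l : E → Ω → ℝ := fun θ ω => Real.exp (N * inner ℝ θ (V ω) - N / 2 * ‖θ‖ ^ 2) with hl
  set g : E → Ω → ℝ := fun θ ω =>
    (φ ω - inner ℝ θ (ψ ω)) * l θ ω * Real.exp (-(κ / 2) * ‖θ‖ ^ 2) with hg
  set Z : ℝ := ∫ v : E, Real.exp (-((N + κ) / 2) * ‖v‖ ^ 2) with hZ
  have hZ0 : 0 < Z := integral_exp_pos (integrable_exp_neg_mul_norm_sq (half_pos hb))
  have hgm : AEStronglyMeasurable (Function.uncurry g) ((volume : Measure E).prod P) := by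
    have hψ' : AEStronglyMeasurable (fun x : E × Ω => ψ x.2) ((volume : Measure E).prod P) :=
      hψ.comp_snd
    have hφ' : AEStronglyMeasurable (fun x : E × Ω => φ x.2) ((volume : Measure E).prod P) :=
      hφ.comp_snd
    have hθ : AEStronglyMeasurable (fun x : E × Ω => x.1) ((volume : Measure E).prod P) :=
      measurable_fst.aestronglyMeasurable
    refine AEStronglyMeasurable.mul (AEStronglyMeasurable.mul (hφ'.sub (hθ.inner hψ')) ?_) ?_
    · exact Measurable.aestronglyMeasurable (by fun_prop)
    · exact Measurable.aestronglyMeasurable (by fun_prop)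
  have hbd : ∀ θ ω, ‖g θ ω‖ ≤ (A + B * ‖θ‖) * Real.exp (-(κ / 2) * ‖θ‖ ^ 2) * l θ ω := by
    intro θ ω
    rw [hg]
    simp only [norm_mul]
    rw [Real.norm_of_nonneg (Real.exp_pos _).le, Real.norm_of_nonneg (Real.exp_pos _).le,
      mul_right_comm]
    have h1 : ‖φ ω - inner ℝ θ (ψ ω)‖ ≤ A + B * ‖θ‖ := by
      refine (norm_sub_le _ _).trans (add_le_add (hφA ω) ?_)
      refine (norm_inner_le_norm _ _).trans ?_
      rw [mul_comm]
      exact mul_le_mul_of_nonneg_right (hψB ω) (norm_nonneg _)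
    gcongr
  have hgθ : ∀ θ, Integrable (g θ) P := by
    intro θ
    refine ((hL θ).const_mul _).mono' ?_ (Filter.Eventually.of_forall (hbd θ))
    refine ((hφ.sub (aestronglyMeasurable_const.inner hψ)).mul (hL θ).1).mul
      aestronglyMeasurable_const
  have hgi : Integrable (Function.uncurry g) ((volume : Measure E).prod P) := by
    rw [integrable_prod_iff hgm]
    refine ⟨Filter.Eventually.of_forall hgθ, ?_⟩
    have hmaj : Integrable (fun θ : E => (A + B * ‖θ‖) * Real.exp (-(κ / 2) * ‖θ‖ ^ 2)) := by
      simp_rw [add_mul, mul_assoc]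
      exact ((integrable_exp_neg_mul_norm_sq (half_pos hκ)).const_mul A).add
        ((integrable_norm_mul_exp_neg_mul_norm_sq (half_pos hκ)).const_mul B)
    refine hmaj.mono' hgm.norm.integral_prod_right' (Filter.Eventually.of_forall fun θ => ?_)
    rw [Real.norm_of_nonneg (integral_nonneg fun ω => norm_nonneg _)]
    -- The likelihood has total mass 1, so only the integrable prior factor remains.
    refine (integral_mono (hgθ θ).norm ((hL θ).const_mul _) (hbd θ)).trans ?_
    rw [integral_const_mul, hL1, mul_one]
  have hin : ∀ ω, ∫ θ, g θ ω = (φ ω - inner ℝ ((N / (N + κ)) • V ω) (ψ ω)) *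
      Real.exp (N ^ 2 / (2 * (N + κ)) * ‖V ω‖ ^ 2) * Z := by
    intro ω
    have : ∀ θ, g θ ω = Real.exp (N ^ 2 / (2 * (N + κ)) * ‖V ω‖ ^ 2) *
        ((φ ω - inner ℝ θ (ψ ω)) *
          Real.exp (-((N + κ) / 2) * ‖θ - (N / (N + κ)) • V ω‖ ^ 2)) := by
      intro θ
      simp only [hg, hl]
      rw [mul_assoc, exp_likelihood_mul_exp_prior hb.ne']
      ring
    simp_rw [this]
    rw [integral_const_mul, integral_affine_mul_exp_neg_mul_norm_sub_sq (half_pos hb)]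
    ring
  have hint : Integrable (fun ω => ∫ θ, g θ ω) P := hgi.integral_prod_right
  have hle : ∫ ω, (∫ θ, g θ ω) ∂P ≤ 0 := by
    rw [← integral_integral_swap hgi]
    refine integral_nonpos fun θ => ?_
    simp only [hg, Pi.zero_apply]
    rw [integral_mul_const]
    exact mul_nonpos_of_nonpos_of_nonneg (hdom θ) (Real.exp_pos _).le
  simp_rw [hin] at hint hle
  rw [integral_mul_const] at hle
  refine ⟨?_, nonpos_of_mul_nonpos_left hle hZ0⟩
  exact (integrable_mul_const_iff (isUnit_iff_ne_zero.2 hZ0.ne') _).1 hint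

end GaussianPrior

/-! ### Blyth's argument and admissibility -/

theorem integral_withDensity_ofReal_exp {Ω : Type*} [MeasurableSpace Ω] {P : Measure Ω}
    {h : Ω → ℝ} (hh : Measurable h) (f : Ω → ℝ) :
    ∫ ω, f ω ∂P.withDensity (fun ω => ENNReal.ofReal (Real.exp (h ω))) =
      ∫ ω, f ω * Real.exp (h ω) ∂P := by
  rw [integral_withDensity_eq_integral_toReal_smul (by fun_prop)
    (Filter.Eventually.of_forall fun _ => ENNReal.ofReal_lt_top)]
  simp_rw [ENNReal.toReal_ofReal (Real.exp_pos _).le, smul_eq_mul, mul_comm]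

theorem integrable_exp_of_isProbabilityMeasure_withDensity {Ω : Type*} [MeasurableSpace Ω]
    {P : Measure Ω} {h : Ω → ℝ} (hh : Measurable h)
    (hP : IsProbabilityMeasure (P.withDensity (fun ω => ENNReal.ofReal (Real.exp (h ω))))) :
    Integrable (fun ω => Real.exp (h ω)) P ∧ ∫ ω, Real.exp (h ω) ∂P = 1 := by
  have h1 : ∫⁻ ω, ENNReal.ofReal (Real.exp (h ω)) ∂P = 1 := by
    have := hP.measure_univ
    rwa [withDensity_apply _ MeasurableSet.univ, Measure.restrict_univ] at this
  constructor
  · refine ⟨by fun_prop, ?_⟩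
    rw [hasFiniteIntegral_iff_ofReal (Filter.Eventually.of_forall fun _ => (Real.exp_pos _).le),
      h1]
    exact ENNReal.one_lt_top
  · rw [integral_eq_lintegral_of_nonneg_ae
      (Filter.Eventually.of_forall fun _ => (Real.exp_pos _).le) (by fun_prop), h1,
      ENNReal.toReal_one]

theorem measurable_sampleMean {d n : ℕ} :
    Measurable (sampleMean : (Fin n → Vec d) → Vec d) := by
  unfold sampleMean
  fun_prop

theorem isProbabilityMeasure_sampleLaw {d : ℕ} (n : ℕ) (S : Matrix (Fin d) (Fin d) ℝ)
    (μ : Vec d) : IsProbabilityMeasure (sampleLaw n (multivariateGaussian μ S)) := by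
  unfold sampleLaw
  infer_instance

/-- The pointwise lower bound behind Blyth's argument: for the weight `exp (s * ‖v‖ ^ 2)` of the
data, the posterior loss of `x` exceeds that of `ballProj R y` by nearly
`‖x - ballProj R y‖ ^ 2 / 2`. -/
theorem half_norm_sub_sq_le_posterior_difference {E : Type*} [NormedAddCommGroup E]
    [InnerProductSpace ℝ E] {R c s K : ℝ} (hR : 0 < R) (hc : 1 / 2 ≤ c) (hc1 : c ≤ 1)
    (hs : 0 ≤ s) (y x : E) (v : ℝ) (hx : ‖x‖ ≤ R) (hv : ‖y‖ ≤ 2 * R → s * v ^ 2 ≤ K) :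
    1 / 2 * ‖x - ballProj R y‖ ^ 2 - (1 - c) * (4 * R ^ 2) * Real.exp K ≤
      ((1 / 2 * ‖x‖ ^ 2 - 1 / 2 * ‖ballProj R y‖ ^ 2) - c * inner ℝ y (x - ballProj R y)) *
        Real.exp (s * v ^ 2) := by
  have h1 : (1 / 2 * ‖x‖ ^ 2 - 1 / 2 * ‖ballProj R y‖ ^ 2) - c * inner ℝ y (x - ballProj R y) =
      1 / 2 * ‖x - ballProj R y‖ ^ 2 + inner ℝ (ballProj R y - c • y) (x - ballProj R y) := by
    rw [← half_norm_sq_sub_inner_sub, real_inner_smul_left, real_inner_smul_left,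
      inner_sub_right]
    ring
  rw [h1, add_mul]
  have he : 1 ≤ Real.exp (s * v ^ 2) := Real.one_le_exp (by positivity)
  have h2 : 1 / 2 * ‖x - ballProj R y‖ ^ 2 ≤
      1 / 2 * ‖x - ballProj R y‖ ^ 2 * Real.exp (s * v ^ 2) :=
    le_mul_of_one_le_right (by positivity) he
  have h0 : 0 ≤ (1 - c) * (4 * R ^ 2) := mul_nonneg (by linarith) (by positivity)
  have h3 : -((1 - c) * (4 * R ^ 2) * Real.exp K) ≤
      inner ℝ (ballProj R y - c • y) (x - ballProj R y) * Real.exp (s * v ^ 2) := by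
    rcases le_or_gt ‖y‖ (2 * R) with hy | hy
    · have h4 := mul_le_mul_of_nonneg_right (le_inner_ballProj_sub_smul hR hc hc1 y hx)
        (Real.exp_pos (s * v ^ 2)).le
      have h5 : (1 - c) * (4 * R ^ 2) * Real.exp (s * v ^ 2) ≤
          (1 - c) * (4 * R ^ 2) * Real.exp K :=
        mul_le_mul_of_nonneg_left (Real.exp_le_exp.2 (hv hy)) h0
      linarith
    · have h4 := mul_nonneg (inner_ballProj_sub_smul_nonneg (c := c) hR (by linarith)
        (by nlinarith) hx) (Real.exp_pos (s * v ^ 2)).le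
      have h5 := mul_nonneg h0 (Real.exp_pos K).le
      linarith
  linarith

/-- A rule whose quadratic risk is nowhere larger than that of the projected sample mean
coincides with it almost everywhere. -/
theorem ae_eq_ballProj_sampleMean {d n : ℕ} (hn : 1 ≤ n) {R : ℝ} (hR : 0 < R)
    {S : Matrix (Fin d) (Fin d) ℝ} (T : Vec d ≃L[ℝ] Vec d)
    (hT : ∀ μ, multivariateGaussian μ S = (stdGaussian (Vec d)).map (fun x => μ + T x))
    {δ : (Fin n → Vec d) → Vec d} (hδ : ∀ y, ‖δ y‖ ≤ R)
    (hm : AEStronglyMeasurable δ (sampleLaw n (multivariateGaussian 0 S)))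
    (hle : ∀ μ, ∫ y, ((1 / 2 * ‖δ y‖ ^ 2 - 1 / 2 * ‖ballProj R (sampleMean y)‖ ^ 2) -
      inner ℝ μ (δ y - ballProj R (sampleMean y)))
        ∂sampleLaw n (multivariateGaussian μ S) ≤ 0) :
    δ =ᵐ[sampleLaw n (multivariateGaussian 0 S)] fun y => ballProj R (sampleMean y) := by
  have hN : (0 : ℝ) < n := by exact_mod_cast hn
  have hP0 := isProbabilityMeasure_sampleLaw n S 0
  have hV : Measurable fun y : Fin n → Vec d => T.symm (sampleMean y) :=
    T.symm.continuous.measurable.comp measurable_sampleMean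
  have hlh : ∀ θ : Vec d, Measurable fun y : Fin n → Vec d =>
      (n : ℝ) * inner ℝ θ (T.symm (sampleMean y)) - n / 2 * ‖θ‖ ^ 2 := fun θ => by fun_prop
  have hp : Measurable fun y : Fin n → Vec d => ballProj R (sampleMean y) :=
    (measurable_ballProj R).comp measurable_sampleMean
  have hdens := sampleLaw_multivariateGaussian_eq_withDensity hn T hT
  have hL := fun θ : Vec d => integrable_exp_of_isProbabilityMeasure_withDensity (hlh θ)
    (hdens θ ▸ isProbabilityMeasure_sampleLaw n S (T θ))
  set P := sampleLaw n (multivariateGaussian (0 : Vec d) S) with hP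
  -- The adjoint moves `T` off the parameter, making the loss difference affine in `θ`.
  set A : Vec d →L[ℝ] Vec d := (T : Vec d →L[ℝ] Vec d).adjoint with hA
  have hAin : ∀ θ w : Vec d, inner ℝ θ (A w) = inner ℝ (T θ) w := fun θ w =>
    ContinuousLinearMap.adjoint_inner_right _ _ _
  set ψ : (Fin n → Vec d) → Vec d := fun y => A (δ y - ballProj R (sampleMean y)) with hψ
  set φ : (Fin n → Vec d) → ℝ := fun y =>
    1 / 2 * ‖δ y‖ ^ 2 - 1 / 2 * ‖ballProj R (sampleMean y)‖ ^ 2 with hφ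
  have hdiff : AEStronglyMeasurable (fun y => δ y - ballProj R (sampleMean y)) P :=
    hm.sub hp.aestronglyMeasurable
  have hψm : AEStronglyMeasurable ψ P := A.continuous.comp_aestronglyMeasurable hdiff
  have hφm : AEStronglyMeasurable φ P := by
    have := hp.aestronglyMeasurable (μ := P)
    fun_prop
  have hnd : ∀ y, ‖δ y - ballProj R (sampleMean y)‖ ≤ 2 * R := fun y =>
    (norm_sub_le _ _).trans (by linarith [hδ y, norm_ballProj_le hR (sampleMean y)])
  have hψB : ∀ y, ‖ψ y‖ ≤ ‖A‖ * (2 * R) := fun y =>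
    (A.le_opNorm _).trans (mul_le_mul_of_nonneg_left (hnd y) (norm_nonneg _))
  have hφA : ∀ y, ‖φ y‖ ≤ R ^ 2 := by
    intro y
    have h1 : ‖δ y‖ ^ 2 ≤ R ^ 2 := pow_le_pow_left₀ (norm_nonneg _) (hδ y) 2
    have h2 : ‖ballProj R (sampleMean y)‖ ^ 2 ≤ R ^ 2 :=
      pow_le_pow_left₀ (norm_nonneg _) (norm_ballProj_le hR _) 2
    rw [Real.norm_eq_abs, abs_le]
    constructor <;> simp only [hφ] <;> nlinarith [sq_nonneg ‖δ y‖,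
      sq_nonneg ‖ballProj R (sampleMean y)‖]
  have hdom : ∀ θ : Vec d, ∫ y, (φ y - inner ℝ θ (ψ y)) *
      Real.exp (n * inner ℝ θ (T.symm (sampleMean y)) - n / 2 * ‖θ‖ ^ 2) ∂P ≤ 0 := by
    intro θ
    have := hle (T θ)
    rw [hdens, integral_withDensity_ofReal_exp (hlh θ)] at this
    simpa only [hψ, hAin] using this
  have hDi : Integrable (fun y => ‖δ y - ballProj R (sampleMean y)‖ ^ 2) P := by
    refine integrable_of_norm_le (hdiff.norm.pow 2) ((2 * R) ^ 2) fun y => ?_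
    rw [Real.norm_of_nonneg (by positivity)]
    exact pow_le_pow_left₀ (norm_nonneg _) (hnd y) 2
  -- Bounds the exponent of the data weight where the sample mean has norm at most `2 * R`,
  -- independently of `κ`.
  set K : ℝ := n / 2 * (‖(T.symm : Vec d →L[ℝ] Vec d)‖ * (2 * R)) ^ 2 with hK
  have hbound : ∀ κ : ℝ, 0 < κ → κ ≤ n →
      1 / 2 * ∫ y, ‖δ y - ballProj R (sampleMean y)‖ ^ 2 ∂P ≤
        κ * (4 * R ^ 2 * Real.exp K / n) := by
    intro κ hκ hκn
    obtain ⟨hi, hnp⟩ := integral_posterior_nonpos hN hκ hV hψm hφm hψB hφA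
      (fun θ => (hL θ).1) (fun θ => (hL θ).2) hdom
    have hc : 1 / 2 ≤ (n : ℝ) / (n + κ) := by
      rw [div_le_div_iff₀ two_pos (by positivity)]; linarith
    have hc1 : (n : ℝ) / (n + κ) ≤ 1 := by
      rw [div_le_one (by positivity)]; linarith
    have hpt : ∀ y, 1 / 2 * ‖δ y - ballProj R (sampleMean y)‖ ^ 2 -
        (1 - (n : ℝ) / (n + κ)) * (4 * R ^ 2) * Real.exp K ≤
        (φ y - inner ℝ (((n : ℝ) / (n + κ)) • T.symm (sampleMean y)) (ψ y)) *
          Real.exp ((n : ℝ) ^ 2 / (2 * (n + κ)) * ‖T.symm (sampleMean y)‖ ^ 2) := by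
      intro y
      rw [hψ, real_inner_smul_left, hAin, T.apply_symm_apply]
      refine half_norm_sub_sq_le_posterior_difference hR hc hc1 (by positivity) _ _ _ (hδ y) ?_
      intro hy
      have h1 : (n : ℝ) ^ 2 / (2 * (n + κ)) ≤ n / 2 := by
        rw [div_le_div_iff₀ (by positivity) two_pos]; nlinarith
      have h2 : ‖T.symm (sampleMean y)‖ ≤ ‖(T.symm : Vec d →L[ℝ] Vec d)‖ * (2 * R) :=
        ((T.symm : Vec d →L[ℝ] Vec d).le_opNorm _).trans
          (mul_le_mul_of_nonneg_left hy (norm_nonneg _))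
      rw [hK]
      gcongr
    have hmono := integral_mono ((hDi.const_mul (1 / 2)).sub (integrable_const _)) hi hpt
    rw [integral_sub' (hDi.const_mul (1 / 2)) (integrable_const _), integral_const_mul,
      integral_const] at hmono
    simp only [probReal_univ, one_smul] at hmono
    have h3 : 1 - (n : ℝ) / (n + κ) ≤ κ / n := by
      rw [one_sub_div (by positivity), add_sub_cancel_left]
      gcongr
      linarith
    have h4 : (1 - (n : ℝ) / (n + κ)) * (4 * R ^ 2 * Real.exp K) ≤
        κ / n * (4 * R ^ 2 * Real.exp K) := mul_le_mul_of_nonneg_right h3 (by positivity)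
    calc _ ≤ (1 - (n : ℝ) / (n + κ)) * (4 * R ^ 2 * Real.exp K) := by linarith
      _ ≤ _ := h4
      _ = _ := by ring
  have hI : ∫ y, ‖δ y - ballProj R (sampleMean y)‖ ^ 2 ∂P ≤ 0 := by
    by_contra! hpos
    set I := ∫ y, ‖δ y - ballProj R (sampleMean y)‖ ^ 2 ∂P with hIdef
    set C : ℝ := 4 * R ^ 2 * Real.exp K / n with hC
    have hC0 : 0 < C := by positivity
    -- This `κ` would give `I / 2 ≤ I / 4`; the minimum with `n` keeps `c ≥ 1/2`.
    have h1 := hbound (min n (I / (4 * C))) (lt_min hN (by positivity)) (min_le_left _ _)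
    have h2 : min (n : ℝ) (I / (4 * C)) * C ≤ I / (4 * C) * C :=
      mul_le_mul_of_nonneg_right (min_le_right _ _) hC0.le
    have h3 : I / (4 * C) * C = I / 4 := by field_simp
    linarith
  have hI0 := le_antisymm hI (integral_nonneg fun y => sq_nonneg _)
  rw [integral_eq_zero_iff_of_nonneg (fun y => sq_nonneg _) hDi] at hI0
  filter_upwards [hI0] with y hy
  exact sub_eq_zero.1 (norm_eq_zero.1 (pow_eq_zero_iff two_ne_zero |>.1 hy))

theorem isAdmissible_ballProj_sampleMean {d n : ℕ} (hn : 1 ≤ n) {R : ℝ} (hR : 0 < R)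
    {S : Matrix (Fin d) (Fin d) ℝ} (hS : S.PosDef) :
    IsAdmissible quadObjective (Metric.closedBall 0 R)
      (fun μ : Vec d => multivariateGaussian μ S) n
      (fun y => ballProj R (sampleMean y)) := by
  have hp : Measurable fun y : Fin n → Vec d => ballProj R (sampleMean y) :=
    (measurable_ballProj R).comp measurable_sampleMean
  have hpR : ∀ y : Fin n → Vec d, ‖ballProj R (sampleMean y)‖ ≤ R := fun y =>
    norm_ballProj_le hR _
  have hprob := isProbabilityMeasure_sampleLaw n S
  refine ⟨⟨fun y => mem_closedBall_zero_iff.2 (hpR y), fun μ =>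
    integrable_of_norm_le hp.aestronglyMeasurable R hpR⟩, ?_⟩
  rintro δ ⟨hδX, hδi⟩ ⟨hle, μ₀, hlt⟩
  have hδ : ∀ y, ‖δ y‖ ≤ R := fun y => mem_closedBall_zero_iff.1 (hδX y)
  obtain ⟨T, hT⟩ := exists_continuousLinearEquiv_multivariateGaussian hS
  have hint : ∀ (μ : Vec d) (η : (Fin n → Vec d) → Vec d), (∀ y, ‖η y‖ ≤ R) →
      AEStronglyMeasurable η (sampleLaw n (multivariateGaussian μ S)) →
      Integrable (fun y => 1 / 2 * ‖η y‖ ^ 2 - inner ℝ μ (η y))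
        (sampleLaw n (multivariateGaussian μ S)) := by
    intro μ η hη hm
    refine Integrable.sub (integrable_of_norm_le (by fun_prop) (1 / 2 * R ^ 2) fun y => ?_)
      ((integrable_of_norm_le hm R hη).const_inner μ)
    rw [Real.norm_of_nonneg (by positivity)]
    have := hη y
    gcongr
  have hae := ae_eq_ballProj_sampleMean hn hR T hT hδ (hδi 0).1 fun μ => by
    have h := hle μ
    rw [risk_quadObjective S μ hδ (hδi μ).1,
      risk_quadObjective S μ hpR hp.aestronglyMeasurable, sub_le_sub_iff_right,
      ← sub_nonpos, ← integral_sub (hint μ δ hδ (hδi μ).1)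
        (hint μ _ hpR hp.aestronglyMeasurable)] at h
    refine le_of_eq_of_le (integral_congr_ae (Filter.Eventually.of_forall fun y => ?_)) h
    simp only [inner_sub_right]
    ring
  have hac : sampleLaw n (multivariateGaussian μ₀ S) ≪ sampleLaw n (multivariateGaussian 0 S) := by
    have h := sampleLaw_multivariateGaussian_eq_withDensity hn T hT (T.symm μ₀)
    rw [T.apply_symm_apply] at h
    rw [h]
    exact withDensity_absolutelyContinuous _ _
  refine hlt.ne (integral_congr_ae ?_)
  filter_upwards [hac.ae_le hae] with y hy
  rw [hy]

theorem theorem3 (d n : ℕ) (hd : 1 ≤ d) (hn : 1 ≤ n) (R : ℝ) (hR : 0 < R)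
    (S : Matrix (Fin d) (Fin d) ℝ) (hS : S.PosDef) :
    (∃! δ : (Fin n → Vec d) → Vec d,
      IsSampleAverageRule quadObjective (Metric.closedBall 0 R) n δ) ∧
    ∀ δ : (Fin n → Vec d) → Vec d,
      IsSampleAverageRule quadObjective (Metric.closedBall 0 R) n δ →
        (∀ y, IsProjection (Metric.closedBall 0 R) (sampleMean y) (δ y)) ∧
        IsAdmissible quadObjective (Metric.closedBall 0 R)
          (fun μ : Vec d => multivariateGaussian μ S) n δ := by
  have h := isSampleAverageRule_quadObjective_iff (d := d) hn hR
  refine ⟨⟨_, (h _).2 rfl, fun δ hδ => (h δ).1 hδ⟩, fun δ hδ => ?_⟩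
  obtain rfl := (h δ).1 hδ
  refine ⟨fun y => ⟨mem_closedBall_zero_iff.2 (norm_ballProj_le hR _), fun x hx =>
    dist_ballProj_le hR _ (mem_closedBall_zero_iff.1 hx)⟩,
    isAdmissible_ballProj_sampleMean hn hR hS⟩
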